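/- **Setting.** Let $\mathcal X\subseteq\mathbb R^n$ be a measurable set of finite positive Lebesgue measure, let $\mathrm P_x$ be the uniform probability distribution on $\mathcal X$, and let $f:\mathbb R^n\to\mathbb R^n$ be continuous (the system is $x(t+1)=f(x(t))$). Let $\epsilon_0>0$, $\gamma\in(0,1)$, $\overline\lambda\in\mathbb R$, $U_1,\dots,U_m\ge\epsilon_0$, and put $B=\prod_{l=1}^m[-U_l,U_l]$. Let $x_0\in\mathcal X$ be such that $V\cap\mathcal X$ has positive Lebesgue measure for every neighbourhood $V$ of $x_0$ (for instance, $x_0$ in the interior of $\mathcal X$). Let $h:\mathbb R^m\times\mathbb R^n\to\mathbb R$ be such that $a\mapsto h(a,x)$ is affine for every $x$; for every $a$ the function $h(a,\cdot)$ is measurable, and continuous on $\mathcal X$; and $h(a,x)<0$ for all $x\notin\mathcal X$ and $a\in B$. Fix states $x'_1,\dots,x'_{N'}\in\mathcal X$. For a sample set $\mathbb X=(x_1,\dots,x_N)\in\mathcal X^N$, $N\ge 1$, consider the linear program $$\min_{a\in\mathbb R^m,\ \lambda\in\mathbb R}\ \lambda\quad\text{s.t.}\quad h(a,x_0)\ge\epsilon_0,\quad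 h(a,f(x_i))\ge\gamma h(a,x_i)-\lambda\ (i=1,\dots,N),\quad \lambda\in[0,\overline\lambda],\quad a\in B,\tag{1}$$ and the tie-break program $$\max_{a\in\mathbb R^m}\ \sum_{i=1}^{N'}h(a,x'_i)\quad\text{s.t.}\quad h(a,x_0)\ge\epsilon_0,\quad h(a,f(x_i))\ge\gamma h(a,x_i)\ (i=1,\dots,N),\quad a\in B.\tag{2}$$ Assume that (1) is feasible for every $\mathbb X\in\mathcal X^N$. Let $(a^*(\mathbb X),\lambda^*(\mathbb X))$ be an optimal solution of (1) where, if $\lambda^*(\mathbb X)=0$, $a^*(\mathbb X)$ is moreover an optimal solution of (2); assume that, for $\mathrm P_x^N$-almost every $\mathbb X$ with $\lambda^*(\mathbb X)=0$, the optimal solution of (2) is unique. Put $\widetilde{\mathbb S}(\mathbb X)=\{x\in\mathcal X\mid h(a^*(\mathbb X),x)\ge0\}$. **Proposition.** Let $\alpha,\beta\in(0,1)$ and $\alpha\ge\frac2N\left(\ln\frac1\beta+m+1\right)$. If $\mathbb X=(x_1,\dots,x_N)$ is drawn i.i.d. from $\mathrm P_x$, then with confidence at least $1-\beta$ (that is,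 for all $\mathbb X$ in a measurable set of $\mathrm P_x^N$-probability at least $1-\beta$) the following holds: if $\lambda^*(\mathbb X)=0$, then $\mathrm P_x[x\in\widetilde{\mathbb S}(\mathbb X)]>0$ and $$\mathrm P_x\big[f(x)\in\widetilde{\mathbb S}(\mathbb X)\mid x\in\widetilde{\mathbb S}(\mathbb X)\big]\ \ge\ 1-\frac{\alpha}{\mathrm P_x[x\in\widetilde{\mathbb S}(\mathbb X)]}.$$ -/

import Mathlib

open MeasureTheory ProbabilityTheory Topology

namespace PACInvariance

/-- The state space `ℝⁿ`. -/
abbrev State (n : ℕ) := EuclideanSpace ℝ (Fin n)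

/-- The parameter space `ℝᵐ`. -/
abbrev Param (m : ℕ) := Fin m → ℝ

/-- The uniform probability distribution on a set of finite positive Lebesgue measure
(normalized Lebesgue measure). -/
noncomputable def uniformDist {n : ℕ} (𝒳 : Set (State n)) : Measure (State n) :=
  (volume : Measure (State n))[|𝒳]

/-- The law of `N` i.i.d. samples drawn uniformly from `𝒳`. -/
noncomputable def sampleDist {n : ℕ} (𝒳 : Set (State n)) (N : ℕ) :
    Measure (Fin N → State n) :=
  Measure.pi fun _ => uniformDist 𝒳

/-- The box `a_l ∈ [-U_l, U_l]`, `l = 1, …, m`. -/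
def InBox {m : ℕ} (U : Fin m → ℝ) (a : Param m) : Prop :=
  ∀ l, a l ∈ Set.Icc (-U l) (U l)

/-- Feasibility of `(a, lam)` for the sampled linear program. -/
def LPFeasible {n m N : ℕ} (f : State n → State n) (h : Param m → State n → ℝ)
    (x₀ : State n) (ε₀ γ lamBar : ℝ) (U : Fin m → ℝ) (X : Fin N → State n)
    (a : Param m) (lam : ℝ) : Prop :=
  ε₀ ≤ h a x₀ ∧ (∀ i, γ * h a (X i) - lam ≤ h a (f (X i))) ∧
    lam ∈ Set.Icc 0 lamBar ∧ InBox U a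

/-- `(a, lam)` is an optimal solution of the sampled linear program, which minimizes `lam`. -/
def IsLPOptimal {n m N : ℕ} (f : State n → State n) (h : Param m → State n → ℝ)
    (x₀ : State n) (ε₀ γ lamBar : ℝ) (U : Fin m → ℝ) (X : Fin N → State n)
    (a : Param m) (lam : ℝ) : Prop :=
  LPFeasible f h x₀ ε₀ γ lamBar U X a lam ∧
    ∀ a' lam', LPFeasible f h x₀ ε₀ γ lamBar U X a' lam' → lam ≤ lam'

/-- Feasibility of `a` for the tie-break program. -/
def TieBreakFeasible {n m N : ℕ} (f : State n → State n) (h : Param m → State n → ℝ)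
    (x₀ : State n) (ε₀ γ : ℝ) (U : Fin m → ℝ) (X : Fin N → State n) (a : Param m) : Prop :=
  ε₀ ≤ h a x₀ ∧ (∀ i, γ * h a (X i) ≤ h a (f (X i))) ∧ InBox U a

/-- `a` is an optimal solution of the tie-break program, which maximizes `∑ i, h (a, x' i)`
over the fixed states `x' i`. -/
def IsTieBreakOptimal {n m N N' : ℕ} (f : State n → State n) (h : Param m → State n → ℝ)
    (x₀ : State n) (ε₀ γ : ℝ) (U : Fin m → ℝ) (x' : Fin N' → State n)
    (X : Fin N → State n) (a : Param m) : Prop :=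
  TieBreakFeasible f h x₀ ε₀ γ U X a ∧
    ∀ a', TieBreakFeasible f h x₀ ε₀ γ U X a' → ∑ i, h a' (x' i) ≤ ∑ i, h a (x' i)

/-- The zero-superlevel set of `h (a, ·)` within `𝒳`. -/
def superlevel {n m : ℕ} (𝒳 : Set (State n)) (h : Param m → State n → ℝ) (a : Param m) :
    Set (State n) :=
  {x | x ∈ 𝒳 ∧ 0 ≤ h a x}

end PACInvariance

/-! If `λ* = 0`, then `a*` maximizes an affine objective over a compact convex set `K` cut by the
`N` random affine constraints `h(a, f(x_i)) - γ h(a, x_i) ≥ 0`. A state of the superlevel set whose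
image leaves it violates this constraint at `a*`. So it suffices that, with confidence `1 - β`, the
violation probability of `a*` is at most `α`; conditioning divides by the mass of the superlevel
set.

For this scenario bound, Helly's theorem gives a set `S` of at most `m` samples that determines the
optimum (`IsLexOptimal.exists_basis`). Every `R ⊇ S` then yields the same point, which no sample
outside `R` violates. If the point has violation probability above `α`, this is an event of
probability at most `(1 - α)^(N - |R|)`, by independence (`measure_undetectedSet_le`). A bad sample
set lies in at least `2^(N - m)` of these events, while their probabilities sum over all `R` to at
most `(2 - α)^N`. By Markov, bad sample sets have probability at most `2^m (1 - α/2)^N ≤ β`.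

Programs on subsamples may have several optima; a strictly concave secondary objective makes the
choice unique and measurable. -/

namespace PACInvariance

/-! ### Measurable dependence of optima on parameters -/

section MeasurableOptimum

variable {Ω E : Type*} [MeasurableSpace Ω] [PseudoMetricSpace E] [SecondCountableTopology E]

/-- Projections along a compact set of superlevel sets of Carathéodory functions are measurable. -/
theorem measurableSet_exists_mem_nonneg {K : Set E} (hK : IsCompact K) {F : E → Ω → ℝ}
    (hFc : ∀ ω, Continuous fun a => F a ω) (hFm : ∀ a, Measurable (F a)) :
    MeasurableSet {ω | ∃ a ∈ K, 0 ≤ F a ω} := by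
  obtain ⟨D, hDc, hD⟩ := TopologicalSpace.exists_countable_dense K
  -- The maximum over `K` is attained, so it is nonnegative as soon as values on a countable dense
  -- subset exceed every `-1/(n+1)`.
  have key : {ω | ∃ a ∈ K, 0 ≤ F a ω} =
      ⋂ n : ℕ, ⋃ d ∈ D, {ω | -(1 / ((n : ℝ) + 1)) < F (d : K) ω} := by
    ext ω
    simp only [Set.mem_ofPred_eq, Set.mem_iInter, Set.mem_iUnion, exists_prop]
    constructor
    · rintro ⟨a, haK, ha⟩ n
      have hopen : IsOpen {d : K | -(1 / ((n : ℝ) + 1)) < F d ω} :=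
        isOpen_lt continuous_const ((hFc ω).comp continuous_subtype_val)
      have hpos : (0 : ℝ) < 1 / ((n : ℝ) + 1) := Nat.one_div_pos_of_nat
      obtain ⟨d, hd, hdD⟩ := hD.inter_open_nonempty _ hopen
        ⟨⟨a, haK⟩, by change -(1 / ((n : ℝ) + 1)) < F a ω; linarith⟩
      exact ⟨d, hdD, hd⟩
    · intro hω
      obtain ⟨d₀, -, -⟩ := hω 0
      obtain ⟨a, haK, ha⟩ := hK.exists_isMaxOn ⟨d₀, d₀.2⟩ (hFc ω).continuousOn
      refine ⟨a, haK, ?_⟩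
      by_contra! hneg
      obtain ⟨n, hn⟩ := exists_nat_one_div_lt (neg_pos.2 hneg)
      obtain ⟨d, -, hd⟩ := hω n
      have := ha d.2
      simp only [Set.mem_ofPred_eq] at this
      linarith
  rw [key]
  exact MeasurableSet.iInter fun n => MeasurableSet.biUnion hDc fun d _ =>
    measurableSet_lt measurable_const (hFm d)

/-- The maximum of a continuous function over a compact set with a Carathéodory constraint
is a measurable function of the parameter. -/
theorem exists_measurable_max [Nonempty E] {K : Set E} (hK : IsCompact K) {F : E → Ω → ℝ}
    (hFc : ∀ ω, Continuous fun a => F a ω) (hFm : ∀ a, Measurable (F a))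
    {c : E → ℝ} (hc : Continuous c) :
    ∃ v : Ω → ℝ, Measurable v ∧ ∀ ω, (∃ a ∈ K, 0 ≤ F a ω) →
      (∀ a ∈ K, 0 ≤ F a ω → c a ≤ v ω) ∧ ∃ b ∈ K, 0 ≤ F b ω ∧ c b = v ω := by
  classical
  have hmax : ∀ ω, (∃ a ∈ K, 0 ≤ F a ω) →
      ∃ b, (b ∈ K ∧ 0 ≤ F b ω) ∧ ∀ a ∈ K, 0 ≤ F a ω → c a ≤ c b := by
    rintro ω ⟨a, haK, ha⟩
    have hcomp : IsCompact (K ∩ {a | 0 ≤ F a ω}) :=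
      hK.inter_right (isClosed_le continuous_const (hFc ω))
    obtain ⟨b, hb, hbmax⟩ := hcomp.exists_isMaxOn ⟨a, haK, ha⟩ hc.continuousOn
    exact ⟨b, hb, fun a haK ha => hbmax ⟨haK, ha⟩⟩
  choose! b hb hbmax using hmax
  have hfeas := measurableSet_exists_mem_nonneg hK hFc hFm
  refine ⟨fun ω => if ∃ a ∈ K, 0 ≤ F a ω then c (b ω) else 0, ?_, ?_⟩
  · refine measurable_of_Ici fun t => ?_
    -- A maximum is at least `t` iff some feasible point has value at least `t`, again a projection.
    -- Infeasible parameters take the default value 0, whence `t ≤ 0`.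
    have key : (fun ω => if ∃ a ∈ K, 0 ≤ F a ω then c (b ω) else 0) ⁻¹' Set.Ici t =
        {ω | ∃ a ∈ K, 0 ≤ min (F a ω) (c a - t)} ∪
          ({ω | ∃ a ∈ K, 0 ≤ F a ω}ᶜ ∩ {_ω | t ≤ 0}) := by
      ext ω
      by_cases hω : ∃ a ∈ K, 0 ≤ F a ω
      · simp only [Set.mem_preimage, Set.mem_Ici, Set.mem_union, Set.mem_ofPred_eq,
          Set.mem_inter_iff, Set.mem_compl_iff, hω, not_true_eq_false, if_true, false_and, or_false,
          le_min_iff, sub_nonneg]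
        constructor
        · exact fun h => ⟨b ω, (hb ω hω).1, (hb ω hω).2, h⟩
        · rintro ⟨a, haK, ha, hta⟩
          exact hta.trans (hbmax ω hω a haK ha)
      · have : ¬ ∃ a ∈ K, 0 ≤ min (F a ω) (c a - t) := by
          rintro ⟨a, haK, ha⟩
          exact hω ⟨a, haK, (le_min_iff.1 ha).1⟩
        rw [Set.mem_preimage, if_neg hω, Set.mem_Ici, Set.mem_union, Set.mem_ofPred_eq,
          or_iff_right this, Set.mem_inter_iff, Set.mem_compl_iff, Set.mem_ofPred_eq,
          Set.mem_ofPred_eq, and_iff_right hω]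
    rw [key]
    refine MeasurableSet.union (measurableSet_exists_mem_nonneg hK (fun ω => ?_) fun a => ?_)
      (hfeas.compl.inter (MeasurableSet.const _))
    · exact (hFc ω).min (hc.sub continuous_const)
    · exact (hFm a).min measurable_const
  · intro ω hω
    simp only [if_pos hω]
    exact ⟨hbmax ω hω, b ω, (hb ω hω).1, (hb ω hω).2, rfl⟩

/-- If a point subject to a Carathéodory constraint is unique, it depends measurably on the
parameter. -/
theorem exists_measurable_selection_of_unique [MeasurableSpace E] [BorelSpace E] [Nonempty E]
    {K : Set E} (hK : IsCompact K) {F : E → Ω → ℝ}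
    (hFc : ∀ ω, Continuous fun a => F a ω) (hFm : ∀ a, Measurable (F a))
    (huniq : ∀ ω, ∀ a ∈ K, ∀ b ∈ K, 0 ≤ F a ω → 0 ≤ F b ω → a = b) :
    ∃ s : Ω → E, Measurable s ∧ ∀ ω, (∃ a ∈ K, 0 ≤ F a ω) → s ω ∈ K ∧ 0 ≤ F (s ω) ω := by
  classical
  let e : E := Classical.arbitrary E
  have hex : ∀ ω, (∃ a ∈ K, 0 ≤ F a ω) → ∃ b, b ∈ K ∧ 0 ≤ F b ω := fun ω h => h
  choose! b hbK hb using hex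
  have hfeas := measurableSet_exists_mem_nonneg hK hFc hFm
  refine ⟨fun ω => if ∃ a ∈ K, 0 ≤ F a ω then b ω else e, ?_, ?_⟩
  · refine measurable_of_isClosed fun C hC => ?_
    -- By uniqueness, the chosen point lies in `C` iff some feasible point does.
    have key : (fun ω => if ∃ a ∈ K, 0 ≤ F a ω then b ω else e) ⁻¹' C =
        {ω | ∃ a ∈ K ∩ C, 0 ≤ F a ω} ∪ ({ω | ∃ a ∈ K, 0 ≤ F a ω}ᶜ ∩ {_ω | e ∈ C}) := by
      ext ω
      by_cases hω : ∃ a ∈ K, 0 ≤ F a ω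
      · simp only [Set.mem_preimage, Set.mem_union, Set.mem_ofPred_eq,
          Set.mem_inter_iff, Set.mem_compl_iff, hω, not_true_eq_false, if_true, false_and, or_false]
        constructor
        · exact fun h => ⟨b ω, ⟨hbK ω hω, h⟩, hb ω hω⟩
        · rintro ⟨a, ⟨haK, haC⟩, ha⟩
          rwa [huniq ω (b ω) (hbK ω hω) a haK (hb ω hω) ha]
      · have : ¬ ∃ a ∈ K ∩ C, 0 ≤ F a ω := by
          rintro ⟨a, haK, ha⟩
          exact hω ⟨a, haK.1, ha⟩
        rw [Set.mem_preimage, if_neg hω, Set.mem_union, Set.mem_ofPred_eq, or_iff_right this,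
          Set.mem_inter_iff, Set.mem_compl_iff, Set.mem_ofPred_eq, Set.mem_ofPred_eq,
          and_iff_right hω]
    rw [key]
    exact (measurableSet_exists_mem_nonneg (hK.inter_right hC) hFc hFm).union
      (hfeas.compl.inter (MeasurableSet.const _))
  · intro ω hω
    simp only [if_pos hω]
    exact ⟨hbK ω hω, hb ω hω⟩

end MeasurableOptimum

/-! ### Lexicographic optima and Helly's theorem -/

section LexOptimum

variable {Ω E : Type*} [NormedAddCommGroup E] [NormedSpace ℝ E]

/-- The points of `K` that satisfy the affine constraints `0 ≤ G (y i)`. -/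
def feasibleSet {ι : Type*} (K : Set E) (G : Ω → E →ᵃ[ℝ] ℝ) (y : ι → Ω) : Set E :=
  {a | a ∈ K ∧ ∀ i, 0 ≤ G (y i) a}

/-- The strict lexicographic comparison of `a` and `b` by the values of `c`, then of `q`. -/
def LexBetter (c : E →ᵃ[ℝ] ℝ) (q : E → ℝ) (a b : E) : Prop :=
  c b < c a ∨ c a = c b ∧ q b < q a

/-- `a` is lexicographically optimal over the feasible set. -/
def IsLexOptimal {ι : Type*} (K : Set E) (G : Ω → E →ᵃ[ℝ] ℝ) (c : E →ᵃ[ℝ] ℝ) (q : E → ℝ)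
    (y : ι → Ω) (a : E) : Prop :=
  a ∈ feasibleSet K G y ∧ ∀ b ∈ feasibleSet K G y, ¬ LexBetter c q b a

theorem convex_feasibleSet {ι : Type*} {K : Set E} (hK : Convex ℝ K) (G : Ω → E →ᵃ[ℝ] ℝ)
    (y : ι → Ω) : Convex ℝ (feasibleSet K G y) := by
  have : feasibleSet K G y = K ∩ ⋂ i, G (y i) ⁻¹' Set.Ici 0 := by
    ext a; simp [feasibleSet]
  rw [this]
  exact hK.inter (convex_iInter fun i => (convex_Ici (0 : ℝ)).affine_preimage (G (y i)))

theorem affine_combo_apply (c : E →ᵃ[ℝ] ℝ) {s t : ℝ} (hst : s + t = 1) (x y : E) :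
    c (s • x + t • y) = s * c x + t * c y := by
  have := Convex.combo_affine_apply (f := c) (x := x) (y := y) hst
  simpa using this

/-- Makes the better points an admissible member of a Helly family. With both weights positive, one
strict gain in `c` suffices; if neither point gains in `c`, concavity of `q` decides. -/
theorem convex_lexBetter (c : E →ᵃ[ℝ] ℝ) {q : E → ℝ} (hq : ConcaveOn ℝ Set.univ q) (a : E) :
    Convex ℝ {b | LexBetter c q b a} := by
  intro x hx y hy s t hs ht hst
  rcases hs.eq_or_lt with rfl | hs'
  · have : t = 1 := by linarith
    subst this; simpa using hy
  rcases ht.eq_or_lt with rfl | ht'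
  · have : s = 1 := by linarith
    subst this; simpa using hx
  have hcomb := affine_combo_apply c hst x y
  have hqc := hq.2 (Set.mem_univ x) (Set.mem_univ y) hs ht hst
  have hsa : c a = s * c a + t * c a := by rw [← add_mul, hst, one_mul]
  have hsq : q a = s * q a + t * q a := by rw [← add_mul, hst, one_mul]
  simp only [smul_eq_mul] at hqc
  change LexBetter c q _ a
  rcases hx with hx | ⟨hx, hx'⟩ <;> rcases hy with hy | ⟨hy, hy'⟩
  · left; rw [hcomb, hsa]; nlinarith [mul_lt_mul_of_pos_left hx hs', mul_lt_mul_of_pos_left hy ht']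
  · left; rw [hcomb, hsa, hy]; nlinarith [mul_lt_mul_of_pos_left hx hs']
  · left; rw [hcomb, hsa, hx]; nlinarith [mul_lt_mul_of_pos_left hy ht']
  · right
    refine ⟨by rw [hcomb, hx, hy, ← hsa], ?_⟩
    rw [hsq]
    nlinarith [mul_lt_mul_of_pos_left hx' hs', mul_lt_mul_of_pos_left hy' ht']

/-- The midpoint of two distinct optima would tie in `c` and be strictly better in `q`. -/
theorem IsLexOptimal.unique {ι : Type*} {K : Set E} (hK : Convex ℝ K) {G : Ω → E →ᵃ[ℝ] ℝ}
    {c : E →ᵃ[ℝ] ℝ} {q : E → ℝ} (hq : StrictConcaveOn ℝ Set.univ q) {y : ι → Ω} {a b : E}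
    (ha : IsLexOptimal K G c q y a) (hb : IsLexOptimal K G c q y b) : a = b := by
  by_contra hab
  have h₁ := ha.2 b hb.1
  have h₂ := hb.2 a ha.1
  simp only [LexBetter, not_or, not_and, not_lt] at h₁ h₂
  have hc : c a = c b := le_antisymm h₂.1 h₁.1
  have hqab : q a = q b := le_antisymm (h₂.2 hc) (h₁.2 hc.symm)
  have hhalf : (1 / 2 : ℝ) + 1 / 2 = 1 := by norm_num
  refine ha.2 ((1 / 2 : ℝ) • a + (1 / 2 : ℝ) • b) (convex_feasibleSet hK G y ha.1 hb.1
    (by norm_num) (by norm_num) hhalf) (Or.inr ⟨?_, ?_⟩)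
  · rw [affine_combo_apply c hhalf, hc]; ring
  · have := hq.2 (Set.mem_univ a) (Set.mem_univ b) hab (by norm_num) (by norm_num) hhalf
    simp only [smul_eq_mul, ← hqab] at this
    linarith

/-- A lexicographic optimum is determined by at most `dim E` of the constraints. -/
theorem IsLexOptimal.exists_basis [FiniteDimensional ℝ E] {ι : Type*} [Fintype ι]
    {K : Set E} (hK : Convex ℝ K) {G : Ω → E →ᵃ[ℝ] ℝ} {c : E →ᵃ[ℝ] ℝ} {q : E → ℝ}
    (hq : ConcaveOn ℝ Set.univ q) {y : ι → Ω} {a : E} (ha : IsLexOptimal K G c q y a) :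
    ∃ S : Finset ι, S.card ≤ Module.finrank ℝ E ∧
      ∀ R : Finset ι, S ⊆ R → IsLexOptimal K G c q (fun i : R => y i) a := by
  classical
  -- Optimality of `a` says that the half-spaces and the better points in `K`, indexed by `none`,
  -- have empty intersection. Helly finds at most `dim E + 1` members with empty intersection.
  let F : Option ι → Set E := fun o => o.elim (K ∩ {b | LexBetter c q b a})
    fun i => G (y i) ⁻¹' Set.Ici 0
  have hF : ∀ o ∈ (Finset.univ : Finset (Option ι)), Convex ℝ (F o) := by
    rintro (_ | i) -
    · exact hK.inter (convex_lexBetter c hq a)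
    · exact (convex_Ici (0 : ℝ)).affine_preimage (G (y i))
  have hempty : ¬ (⋂ o ∈ (Finset.univ : Finset (Option ι)), F o).Nonempty := by
    rintro ⟨b, hb⟩
    simp only [Finset.mem_univ, Set.iInter_true, Set.mem_iInter] at hb
    exact ha.2 b ⟨(hb none).1, fun i => hb (some i)⟩ (hb none).2
  have hnot := mt (Convex.helly_theorem' hF) hempty
  push Not at hnot
  obtain ⟨I, -, hIcard, hI⟩ := hnot
  -- Since `a` lies in every half-space, the subfamily must contain `none`, leaving at most `dim E`
  -- constraints.
  have hnone : none ∈ I := by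
    by_contra hnone
    refine Set.notMem_empty a (hI ▸ ?_)
    simp only [Set.mem_iInter]
    rintro (_ | i) ho
    · exact absurd ho hnone
    · exact ha.1.2 i
  refine ⟨Finset.eraseNone I, ?_, fun R hR => ⟨⟨ha.1.1, fun i => ha.1.2 i⟩, ?_⟩⟩
  · have := Finset.card_eraseNone_of_mem hnone
    omega
  · rintro b ⟨hbK, hb⟩ hbetter
    refine Set.notMem_empty b (hI ▸ ?_)
    simp only [Set.mem_iInter]
    rintro (_ | i) ho
    · exact ⟨hbK, hbetter⟩
    · exact hb ⟨i, hR (Finset.mem_eraseNone.2 ho)⟩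

/-- The lexicographic optimum is a measurable function of the constraints. -/
theorem exists_measurable_isLexOptimal [FiniteDimensional ℝ E] [MeasurableSpace E] [BorelSpace E]
    [MeasurableSpace Ω] {ι : Type*} [Fintype ι] {K : Set E} (hKc : IsCompact K)
    (hK : Convex ℝ K) {G : Ω → E →ᵃ[ℝ] ℝ} (hG : ∀ a, Measurable fun x => G x a)
    (c : E →ᵃ[ℝ] ℝ) {q : E → ℝ} (hq : StrictConcaveOn ℝ Set.univ q) (hqc : Continuous q) :
    ∃ s : (ι → Ω) → E, Measurable s ∧
      ∀ y, (feasibleSet K G y).Nonempty → IsLexOptimal K G c q y (s y) := by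
  have : ProperSpace E := FiniteDimensional.proper ℝ E
  have : SecondCountableTopology E := inferInstance
  have hcc : Continuous c := c.continuous_of_finiteDimensional
  -- One function encodes all constraints; `F₁` and `F₂` below add optimality in `c`, then in `q`,
  -- as further constraints through the measurable optimal values `v` and `w`.
  let F₀ : E → (ι → Ω) → ℝ := fun a y => ∑ i, min (G (y i) a) 0
  have hF₀ : ∀ a y, 0 ≤ F₀ a y ↔ ∀ i, 0 ≤ G (y i) a := by
    intro a y
    constructor
    · intro h i
      have hz : ∑ i, min (G (y i) a) 0 = 0 :=
        le_antisymm (Finset.sum_nonpos fun i _ => min_le_right _ _) h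
      have := (Finset.sum_eq_zero_iff_of_nonpos fun i _ => min_le_right _ _).1 hz i
        (Finset.mem_univ i)
      exact min_eq_right_iff.1 this
    · exact fun h => Finset.sum_nonneg fun i _ => le_min (h i) le_rfl
  have hF₀c : ∀ y, Continuous fun a => F₀ a y := fun y =>
    continuous_finsetSum _ fun i _ =>
      ((G (y i)).continuous_of_finiteDimensional).min continuous_const
  have hF₀m : ∀ a, Measurable (F₀ a) := fun a =>
    Finset.measurable_sum _ fun i _ =>
      ((hG a).comp (measurable_pi_apply i)).min measurable_const
  obtain ⟨v, hvm, hv⟩ := exists_measurable_max hKc hF₀c hF₀m hcc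
  let F₁ : E → (ι → Ω) → ℝ := fun a y => min (F₀ a y) (c a - v y)
  have hF₁c : ∀ y, Continuous fun a => F₁ a y := fun y =>
    (hF₀c y).min (hcc.sub continuous_const)
  have hF₁m : ∀ a, Measurable (F₁ a) := fun a =>
    (hF₀m a).min (measurable_const.sub hvm)
  obtain ⟨w, hwm, hw⟩ := exists_measurable_max hKc hF₁c hF₁m hqc
  let F₂ : E → (ι → Ω) → ℝ := fun a y => min (F₁ a y) (q a - w y)
  have hF₂c : ∀ y, Continuous fun a => F₂ a y := fun y =>
    (hF₁c y).min (hqc.sub continuous_const)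
  have hF₂m : ∀ a, Measurable (F₂ a) := fun a =>
    (hF₁m a).min (measurable_const.sub hwm)
  have hopt : ∀ y, ∀ a ∈ K, 0 ≤ F₂ a y → IsLexOptimal K G c q y a := by
    intro y a haK ha
    simp only [F₂, F₁, le_min_iff, sub_nonneg] at ha
    obtain ⟨⟨ha₀, ha₁⟩, ha₂⟩ := ha
    have hv' := (hv y ⟨a, haK, ha₀⟩).1
    have hw' := (hw y ⟨a, haK, le_min ha₀ (sub_nonneg.2 ha₁)⟩).1
    refine ⟨⟨haK, (hF₀ a y).1 ha₀⟩, ?_⟩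
    rintro b ⟨hbK, hb⟩ (hlt | ⟨heq, hlt⟩)
    · exact absurd (hv' b hbK ((hF₀ b y).2 hb)) (by linarith)
    · exact absurd (hw' b hbK (le_min ((hF₀ b y).2 hb) (by linarith))) (by linarith)
  obtain ⟨s, hsm, hs⟩ := exists_measurable_selection_of_unique hKc hF₂c hF₂m
    fun y a haK b hbK ha hb => (hopt y a haK ha).unique hK hq (hopt y b hbK hb)
  refine ⟨s, hsm, ?_⟩
  rintro y ⟨a, haK, ha⟩
  obtain ⟨-, b, hbK, hb, hbv⟩ := hv y ⟨a, haK, (hF₀ a y).2 ha⟩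
  obtain ⟨-, b', hbK', hb', hbw⟩ := hw y ⟨b, hbK, le_min hb (by linarith)⟩
  obtain ⟨h₁, h₂⟩ := hs y ⟨b', hbK', le_min hb' (by linarith)⟩
  exact hopt y _ h₁ h₂

end LexOptimum

/-! ### Averaging over subsets of the samples -/

section Thinning

variable {Ω E : Type*} [MeasurableSpace Ω] [MeasurableSpace E]

/-- The sample sets for which the point computed from the samples in `R` has violation
probability above `α` although no sample outside `R` violates it. -/
def undetectedSet {ι : Type*} (μ : Measure Ω) (W : Set (E × Ω)) (α : ℝ) (R : Finset ι)
    (s : (R → Ω) → E) : Set (ι → Ω) :=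
  {X | α < μ.real (Prod.mk (s fun i => X i) ⁻¹' W) ∧ ∀ i ∉ R, (s fun i => X i, X i) ∉ W}

theorem measurableSet_undetectedSet {ι : Type*} [Fintype ι] (μ : Measure Ω) [SFinite μ]
    {W : Set (E × Ω)} (hW : MeasurableSet W) (α : ℝ) (R : Finset ι) {s : (R → Ω) → E}
    (hs : Measurable s) : MeasurableSet (undetectedSet μ W α R s) := by
  have hsX : Measurable fun X : ι → Ω => s fun i : R => X i :=
    hs.comp (measurable_pi_lambda _ fun i => measurable_pi_apply _)
  have hV : Measurable fun X : ι → Ω => μ.real (Prod.mk (s fun i : R => X i) ⁻¹' W) :=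
    ((measurable_measure_prodMk_left hW).comp hsX).ennreal_toReal
  have : undetectedSet μ W α R s =
      {X | α < μ.real (Prod.mk (s fun i => X i) ⁻¹' W)} ∩
        ⋂ i : ι, ⋂ _ : i ∉ R, (fun X : ι → Ω => (s fun j : R => X j, X i)) ⁻¹' Wᶜ := by
    ext X; simp [undetectedSet]
  rw [this]
  exact (measurableSet_lt measurable_const hV).inter <| MeasurableSet.iInter fun i =>
    MeasurableSet.iInter fun _ => (hsX.prodMk (measurable_pi_apply i)) hW.compl

/-- The samples outside `R` are independent of the point computed from the samples in `R`. -/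
theorem measure_undetectedSet_le {N : ℕ} (μ : Measure Ω) [IsProbabilityMeasure μ]
    {W : Set (E × Ω)} (hW : MeasurableSet W) {α : ℝ} (R : Finset (Fin N))
    {s : (R → Ω) → E} (hs : Measurable s) :
    Measure.pi (fun _ : Fin N => μ) (undetectedSet μ W α R s) ≤
      ENNReal.ofReal (1 - α) ^ (N - R.card) := by
  classical
  let e := MeasurableEquiv.piEquivPiSubtypeProd (fun _ : Fin N => Ω) (· ∈ R)
  have hpres := measurePreserving_piEquivPiSubtypeProd (fun _ : Fin N => μ) (· ∈ R)
  let B : Set ((R → Ω) × ({i // i ∉ R} → Ω)) :=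
    {p | α < μ.real (Prod.mk (s p.1) ⁻¹' W) ∧ ∀ i, (s p.1, p.2 i) ∉ W}
  have hBe : undetectedSet μ W α R s = e ⁻¹' B := by
    ext X
    refine and_congr Iff.rfl ⟨fun h i => h i i.2, fun h i hi => h ⟨i, hi⟩⟩
  have hB : MeasurableSet B := by
    have hs₁ : Measurable fun p : (R → Ω) × ({i // i ∉ R} → Ω) => s p.1 := hs.comp measurable_fst
    have hV : Measurable fun p : (R → Ω) × ({i // i ∉ R} → Ω) =>
        μ.real (Prod.mk (s p.1) ⁻¹' W) :=
      ((measurable_measure_prodMk_left hW).comp hs₁).ennreal_toReal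
    have : B = {p | α < μ.real (Prod.mk (s p.1) ⁻¹' W)} ∩
        ⋂ i, (fun p : (R → Ω) × ({i // i ∉ R} → Ω) => (s p.1, p.2 i)) ⁻¹' Wᶜ := by
      ext p; simp [B]
    rw [this]
    exact (measurableSet_lt measurable_const hV).inter <| MeasurableSet.iInter fun i =>
      (hs₁.prodMk ((measurable_pi_apply i).comp measurable_snd)) hW.compl
  rw [hBe, hpres.measure_preimage hB.nullMeasurableSet, Measure.prod_apply hB]
  have hsec : ∀ y : R → Ω, Measure.pi (fun _ : {i // i ∉ R} => μ) (Prod.mk y ⁻¹' B) ≤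
      ENNReal.ofReal (1 - α) ^ (N - R.card) := by
    intro y
    by_cases hy : α < μ.real (Prod.mk (s y) ⁻¹' W)
    -- With the samples in `R` frozen, each of the other `N - |R|` independently avoids a set of
    -- mass above `α`.
    · have hset : Prod.mk y ⁻¹' B =
          Set.univ.pi fun _ : {i // i ∉ R} => (Prod.mk (s y) ⁻¹' W)ᶜ := by
        ext z; simp [B, hy]
      have hmeas : MeasurableSet (Prod.mk (s y) ⁻¹' W) := measurable_prodMk_left hW
      have hle : μ (Prod.mk (s y) ⁻¹' W)ᶜ ≤ ENNReal.ofReal (1 - α) := by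
        rw [← ofReal_measureReal, probReal_compl_eq_one_sub hmeas]
        exact ENNReal.ofReal_le_ofReal (by linarith)
      have hcard : Fintype.card {i // i ∉ R} = N - R.card := by
        rw [Fintype.card_subtype_compl]; simp
      rw [hset, Measure.pi_pi, Finset.prod_const, Finset.card_univ, hcard]
      exact pow_le_pow_left' hle _
    · have hset : Prod.mk y ⁻¹' B = ∅ := by
        ext z; simp [B, hy]
      rw [hset, measure_empty]; exact zero_le
  exact (lintegral_mono hsec).trans (by simp)

/-- If every sample set in `D` is undetected for all `R` that contain some set of at most `d`
samples, then averaging over random halves `R` of the samples bounds the measure of `D`. -/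
theorem exists_measurableSet_superset_of_basis {N : ℕ} (μ : Measure Ω) [IsProbabilityMeasure μ]
    {W : Set (E × Ω)} (hW : MeasurableSet W) {α : ℝ} (hα : α ≤ 1) (d : ℕ)
    {s : (R : Finset (Fin N)) → (R → Ω) → E} (hs : ∀ R, Measurable (s R))
    {D : Set (Fin N → Ω)}
    (hD : ∀ X ∈ D, ∃ S : Finset (Fin N), S.card ≤ d ∧
      ∀ R, S ⊆ R → X ∈ undetectedSet μ W α R (s R)) :
    ∃ D' : Set (Fin N → Ω), MeasurableSet D' ∧ D ⊆ D' ∧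
      (Measure.pi fun _ : Fin N => μ).real D' ≤ 2 ^ d * (1 - α / 2) ^ N := by
  classical
  let B : Finset (Fin N) → Set (Fin N → Ω) := fun R => undetectedSet μ W α R (s R)
  have hB : ∀ R, MeasurableSet (B R) := fun R => measurableSet_undetectedSet μ hW α R (hs R)
  -- `g` counts the subsets `R` whose event occurs. Its superlevel set `g ≥ 2^(N - d)`, written
  -- without subtraction, is the measurable superset, as `D` need not be measurable.
  let g : (Fin N → Ω) → ENNReal := fun X => ∑ R : Finset (Fin N), (B R).indicator 1 X
  have hg : Measurable g :=
    Finset.measurable_sum _ fun R _ => measurable_one.indicator (hB R)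
  refine ⟨{X | 2 ^ N ≤ 2 ^ d * g X}, measurableSet_le measurable_const (hg.const_mul _), ?_, ?_⟩
  · intro X hX
    obtain ⟨S, hSd, hS⟩ := hD X hX
    have hSN : S.card ≤ N := by simpa using Finset.card_le_univ S
    have hcount : (2 : ENNReal) ^ (N - S.card) ≤ g X := by
      have hcard : (Finset.univ.filter fun R : Finset (Fin N) => S ⊆ R).card =
          2 ^ (N - S.card) := by
        have : (Finset.univ.filter fun R : Finset (Fin N) => S ⊆ R) =
            Finset.Icc S Finset.univ := by
          ext R; simp
        rw [this, Finset.card_Icc_finset (Finset.subset_univ S)]; simp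
      calc (2 : ENNReal) ^ (N - S.card)
          = ∑ R ∈ Finset.univ.filter fun R : Finset (Fin N) => S ⊆ R, (1 : ENNReal) := by
            rw [Finset.sum_const, hcard]; simp
        _ ≤ ∑ R ∈ Finset.univ.filter fun R : Finset (Fin N) => S ⊆ R,
              (B R).indicator (1 : (Fin N → Ω) → ENNReal) X := by
            refine Finset.sum_le_sum fun R hR => ?_
            rw [Set.indicator_of_mem (hS R (Finset.mem_filter.1 hR).2)]; rfl
        _ ≤ g X := Finset.sum_le_sum_of_subset (Finset.filter_subset _ _)
    calc (2 : ENNReal) ^ N = 2 ^ S.card * 2 ^ (N - S.card) := by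
          rw [← pow_add, Nat.add_sub_cancel' hSN]
      _ ≤ 2 ^ d * g X := by
          gcongr
          exact one_le_two
  -- Binomial theorem: the sum of `(1 - α)^(N - |R|)` over all `R` is `(1 + (1 - α))^N`.
  · have hint : ∫⁻ X, 2 ^ d * g X ∂(Measure.pi fun _ : Fin N => μ) ≤
        2 ^ d * (1 + ENNReal.ofReal (1 - α)) ^ N := by
      rw [lintegral_const_mul _ hg, ← Fin.sum_pow_mul_eq_add_pow,
        lintegral_finsetSum _ fun R _ => measurable_one.indicator (hB R)]
      gcongr with R
      rw [lintegral_indicator_one (hB R), one_pow, one_mul]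
      exact measure_undetectedSet_le μ hW R (hs R)
    have hmarkov := (mul_meas_ge_le_lintegral (μ := Measure.pi fun _ : Fin N => μ)
      (hg.const_mul (2 ^ d)) (2 ^ N)).trans hint
    have hreal := ENNReal.toReal_mono (by finiteness) hmarkov
    rw [ENNReal.toReal_mul, ENNReal.toReal_mul, ENNReal.toReal_pow, ENNReal.toReal_pow,
      ENNReal.toReal_pow, ENNReal.toReal_add ENNReal.one_ne_top ENNReal.ofReal_ne_top,
      ENNReal.toReal_ofReal (by linarith)] at hreal
    simp only [ENNReal.toReal_ofNat, ENNReal.toReal_one] at hreal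
    have hpow : (1 - α / 2) ^ N * 2 ^ N = (1 + (1 - α)) ^ N := by
      rw [← mul_pow]; congr 1; ring
    have h2 : (0 : ℝ) < 2 ^ N := by positivity
    refine le_of_mul_le_mul_left ?_ h2
    calc _ ≤ _ := hreal
      _ = _ := by rw [← hpow]; ring

end Thinning

/-! ### The scenario bound and its constants -/

/-- The scenario bound: outside a set of sample sets of probability at most
`2 ^ dim E * (1 - α / 2) ^ N`, a unique optimum of the sampled program has violation probability at
most `α`. -/
theorem exists_measurableSet_violation_le {Ω E : Type*} [MeasurableSpace Ω]
    [NormedAddCommGroup E] [NormedSpace ℝ E] [FiniteDimensional ℝ E] [MeasurableSpace E]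
    [BorelSpace E] {N : ℕ} (μ : Measure Ω) [IsProbabilityMeasure μ] {K : Set E}
    (hKc : IsCompact K) (hK : Convex ℝ K) {G : Ω → E →ᵃ[ℝ] ℝ}
    (hG : ∀ a, Measurable fun x => G x a) (c : E →ᵃ[ℝ] ℝ) {q : E → ℝ}
    (hq : StrictConcaveOn ℝ Set.univ q) (hqc : Continuous q) {α : ℝ} (hα : α ≤ 1) :
    ∃ D : Set (Fin N → Ω), MeasurableSet D ∧
      (Measure.pi fun _ : Fin N => μ).real D ≤ 2 ^ Module.finrank ℝ E * (1 - α / 2) ^ N ∧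
      ∀ X ∉ D, ∀ a ∈ feasibleSet K G X, (∀ b ∈ feasibleSet K G X, c b ≤ c a) →
        (∀ b ∈ feasibleSet K G X, c b = c a → b = a) → μ.real {x | G x a < 0} ≤ α := by
  have : ProperSpace E := FiniteDimensional.proper ℝ E
  have hGm : Measurable (Function.uncurry fun (a : E) (x : Ω) => G x a) :=
    measurable_uncurry_of_continuous_of_measurable
      (fun x => (G x).continuous_of_finiteDimensional) hG
  let W : Set (E × Ω) := {p | G p.2 p.1 < 0}
  have hW : MeasurableSet W := measurableSet_lt hGm measurable_const
  choose s hs hsopt using fun R : Finset (Fin N) =>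
    exists_measurable_isLexOptimal (ι := R) hKc hK hG c hq hqc
  let D₀ : Set (Fin N → Ω) := {X | ∃ a ∈ feasibleSet K G X,
    (∀ b ∈ feasibleSet K G X, c b ≤ c a) ∧
      (∀ b ∈ feasibleSet K G X, c b = c a → b = a) ∧ α < μ.real {x | G x a < 0}}
  obtain ⟨D, hDm, hD₀D, hD⟩ := exists_measurableSet_superset_of_basis (D := D₀) μ hW hα
    (Module.finrank ℝ E) hs (by
      rintro X ⟨a, ha, hmax, huniq, hV⟩
      -- A unique `c`-optimum is lexicographically optimal whatever `q` is, so `q` does not alter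
      -- the solution on the full sample set.
      have hopt : IsLexOptimal K G c q X a := by
        refine ⟨ha, ?_⟩
        rintro b hb (hlt | ⟨heq, hlt⟩)
        · exact absurd (hmax b hb) (not_le.2 hlt)
        · rw [huniq b hb heq] at hlt
          exact lt_irrefl _ hlt
      obtain ⟨S, hS, hSR⟩ := hopt.exists_basis hK hq.concaveOn
      refine ⟨S, hS, fun R hR => ?_⟩
      have hsa : s R (fun i => X i) = a :=
        (hsopt R _ ⟨a, (hSR R hR).1⟩).unique hK hq (hSR R hR)
      refine ⟨?_, fun i _ => ?_⟩
      · rw [hsa]; exact hV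
      · rw [hsa]; exact not_lt.2 (ha.2 i))
  refine ⟨D, hDm, hD, fun X hX a ha hmax huniq => ?_⟩
  by_contra! hV
  exact hX (hD₀D ⟨a, ha, hmax, huniq, hV⟩)

/-- Supplies the secondary objective `q`. The strict gain is `s t ∑ (x_l - y_l)²`. -/
theorem strictConcaveOn_neg_sum_sq (m : ℕ) :
    StrictConcaveOn ℝ Set.univ fun a : Fin m → ℝ => -∑ l, a l ^ 2 := by
  refine ⟨convex_univ, fun x _ y _ hxy s t hs ht hst => ?_⟩
  obtain ⟨l, hl⟩ := Function.ne_iff.1 hxy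
  simp only [smul_eq_mul, Pi.add_apply, Pi.smul_apply]
  have hpos : 0 < ∑ l, (x l - y l) ^ 2 :=
    Finset.sum_pos' (fun i _ => sq_nonneg _)
      ⟨l, Finset.mem_univ l, sq_pos_of_ne_zero (sub_ne_zero.2 hl)⟩
  have hid : ∑ l, (s * x l + t * y l) ^ 2 =
      s * ∑ l, x l ^ 2 + t * ∑ l, y l ^ 2 - s * t * ∑ l, (x l - y l) ^ 2 := by
    rw [Finset.mul_sum, Finset.mul_sum, Finset.mul_sum, ← Finset.sum_add_distrib,
      ← Finset.sum_sub_distrib]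
    refine Finset.sum_congr rfl fun l _ => ?_
    obtain rfl : t = 1 - s := by linarith
    ring
  have := mul_pos (mul_pos hs ht) hpos
  rw [hid]
  linarith

/-- From `2 ≤ e` and `1 - α/2 ≤ exp(-α/2)`, the left side is at most `exp(m - Nα/2)`. The summand 1
in the sample bound is slack. -/
theorem two_pow_mul_pow_le {m N : ℕ} {α β : ℝ} (hα : α ≤ 1) (hβ : 0 < β) (hN : 0 < N)
    (hαN : 2 / (N : ℝ) * (Real.log (1 / β) + m + 1) ≤ α) :
    2 ^ m * (1 - α / 2) ^ N ≤ β := by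
  have hN' : (0 : ℝ) < N := Nat.cast_pos.2 hN
  have h₁ : Real.log (1 / β) + m + 1 ≤ N * (α / 2) := by
    have := mul_le_mul_of_nonneg_left hαN (half_pos hN').le
    calc _ = (N : ℝ) / 2 * (2 / (N : ℝ) * (Real.log (1 / β) + m + 1)) := by field_simp
      _ ≤ _ := this
      _ = _ := by ring
  have h₂ : (1 - α / 2) ^ N ≤ Real.exp (-(N * (α / 2))) := by
    have : -(N * (α / 2)) = N * (-(α / 2)) := by ring
    rw [this, Real.exp_nat_mul]
    exact pow_le_pow_left₀ (by linarith) (by linarith [Real.add_one_le_exp (-(α / 2))]) N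
  have h₃ : (2 : ℝ) ^ m ≤ Real.exp m := by
    rw [← mul_one (m : ℝ), Real.exp_nat_mul]
    exact pow_le_pow_left₀ zero_le_two (by linarith [Real.add_one_le_exp (1 : ℝ)]) m
  calc (2 : ℝ) ^ m * (1 - α / 2) ^ N
      ≤ Real.exp m * Real.exp (-(N * (α / 2))) :=
        mul_le_mul h₃ h₂ (pow_nonneg (by linarith) _) (Real.exp_pos _).le
    _ = Real.exp (m - N * (α / 2)) := by rw [← Real.exp_add]; ring_nf
    _ ≤ Real.exp (Real.log β) := by
        refine Real.exp_le_exp.2 ?_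
        rw [one_div, Real.log_inv] at h₁
        linarith
    _ = β := Real.exp_log hβ

/-! ### Application to the sampled invariance program -/

/-- The affine function `a ↦ φ a + b`. -/
def affineOf {m : ℕ} (φ : Param m →ₗ[ℝ] ℝ) (b : ℝ) : Param m →ᵃ[ℝ] ℝ :=
  φ.toAffineMap + AffineMap.const ℝ (Param m) b

theorem affineOf_apply {m : ℕ} (φ : Param m →ₗ[ℝ] ℝ) (b : ℝ) (a : Param m) :
    affineOf φ b a = φ a + b := rfl

theorem uniformDist_pos_of_volume_ne_zero {n : ℕ} {𝒳 : Set (State n)} (h𝒳 : MeasurableSet 𝒳)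
    (h𝒳_fin : volume 𝒳 ≠ ⊤) {S : Set (State n)} (hS𝒳 : S ⊆ 𝒳) (hS : volume S ≠ 0) :
    uniformDist 𝒳 S ≠ 0 := by
  rw [uniformDist, cond_apply h𝒳, Set.inter_eq_self_of_subset_right hS𝒳]
  exact mul_ne_zero (ENNReal.inv_ne_zero.2 h𝒳_fin) hS

/-- Leaving a set of positive probability with probability at most `α` bounds the conditional
probability of staying in it. -/
theorem one_sub_div_le_cond_real {Ω : Type*} [MeasurableSpace Ω] {μ : Measure Ω}
    [IsProbabilityMeasure μ] {S T : Set Ω} (hS : MeasurableSet S) (hpos : 0 < μ.real S) {α : ℝ}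
    (hα : μ.real (S \ T) ≤ α) : 1 - α / μ.real S ≤ (μ[|S]).real T := by
  have hsplit : μ.real S ≤ μ.real (S ∩ T) + μ.real (S \ T) := by
    conv_lhs => rw [← Set.inter_union_sdiff S T]
    exact measureReal_union_le _ _
  rw [measureReal_def (μ[|S]), cond_apply hS, ENNReal.toReal_mul, ENNReal.toReal_inv,
    ← measureReal_def, ← measureReal_def, one_sub_div hpos.ne', div_eq_inv_mul]
  gcongr
  linarith

end PACInvariance

open PACInvariance

theorem proposition3 {n m N N' : ℕ}
    -- the safe set, carrying the uniform distribution
    (𝒳 : Set (PACInvariance.State n)) (h𝒳 : MeasurableSet 𝒳)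
    (h𝒳_pos : volume 𝒳 ≠ 0) (h𝒳_fin : volume 𝒳 ≠ ⊤)
    -- the dynamics
    (f : PACInvariance.State n → PACInvariance.State n) (hf : Continuous f)
    -- the user-defined parameters and the box of admissible parameter vectors
    (x₀ : PACInvariance.State n) (hx₀ : x₀ ∈ 𝒳) (hx₀_nhds : ∀ V ∈ 𝓝 x₀, volume (V ∩ 𝒳) ≠ 0)
    (ε₀ γ lamBar : ℝ) (hε₀ : 0 < ε₀) (hγ : γ ∈ Set.Ioo (0 : ℝ) 1)
    (U : Fin m → ℝ) (hU : ∀ l, ε₀ ≤ U l)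
    -- the template: affine in the parameter, negative off the safe set, continuous on it
    (h : PACInvariance.Param m → PACInvariance.State n → ℝ)
    (h_affine : ∀ x, ∃ (φ : PACInvariance.Param m →ₗ[ℝ] ℝ) (b : ℝ), ∀ a, h a x = φ a + b)
    (h_neg : ∀ a, PACInvariance.InBox U a → ∀ x, x ∉ 𝒳 → h a x < 0)
    (h_cont : ∀ a, ContinuousOn (h a) 𝒳) (h_meas : ∀ a, Measurable (h a))
    -- the fixed states of the tie-break objective
    (x' : Fin N' → PACInvariance.State n) (hx' : ∀ i, x' i ∈ 𝒳)
    -- the solution of the linear program, for each sample set, with the tie-break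
    (aStar : (Fin N → PACInvariance.State n) → PACInvariance.Param m)
    (lamStar : (Fin N → PACInvariance.State n) → ℝ)
    (h_opt : ∀ X, (∀ i, X i ∈ 𝒳) →
      PACInvariance.IsLPOptimal f h x₀ ε₀ γ lamBar U X (aStar X) (lamStar X))
    (h_tie : ∀ X, (∀ i, X i ∈ 𝒳) → lamStar X = 0 →
      PACInvariance.IsTieBreakOptimal f h x₀ ε₀ γ U x' X (aStar X))
    (h_unique : ∀ᵐ X ∂PACInvariance.sampleDist 𝒳 N, lamStar X = 0 →
      ∀ a, PACInvariance.IsTieBreakOptimal f h x₀ ε₀ γ U x' X a → a = aStar X)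
    (α β : ℝ) (hα : α ∈ Set.Ioo (0 : ℝ) 1) (hβ : β ∈ Set.Ioo (0 : ℝ) 1) (hN : 0 < N)
    (hαN : 2 / (N : ℝ) * (Real.log (1 / β) + m + 1) ≤ α) :
    ∃ G : Set (Fin N → PACInvariance.State n), MeasurableSet G ∧
      1 - β ≤ (PACInvariance.sampleDist 𝒳 N).real G ∧
      ∀ X ∈ G, lamStar X = 0 →
        0 < (PACInvariance.uniformDist 𝒳).real (PACInvariance.superlevel 𝒳 h (aStar X)) ∧
        1 - α / (PACInvariance.uniformDist 𝒳).real (PACInvariance.superlevel 𝒳 h (aStar X)) ≤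
          ((PACInvariance.uniformDist 𝒳)[|PACInvariance.superlevel 𝒳 h (aStar X)]).real
            (f ⁻¹' PACInvariance.superlevel 𝒳 h (aStar X)) := by
  classical
  have hμ : IsProbabilityMeasure (uniformDist 𝒳) :=
    cond_isProbabilityMeasure_of_finite h𝒳_pos h𝒳_fin
  choose φ b hφ using h_affine
  let A : State n → Param m →ᵃ[ℝ] ℝ := fun x =>
    affineOf (φ (f x) - γ • φ x) (b (f x) - γ * b x)
  have hA : ∀ x a, A x a = h a (f x) - γ * h a x := by
    intro x a
    simp only [A, affineOf_apply, hφ, LinearMap.sub_apply, LinearMap.smul_apply, smul_eq_mul]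
    ring
  let c : Param m →ᵃ[ℝ] ℝ := affineOf (∑ i, φ (x' i)) (∑ i, b (x' i))
  have hc : ∀ a, c a = ∑ i, h a (x' i) := by
    intro a
    simp only [c, affineOf_apply, hφ, LinearMap.sum_apply, Finset.sum_add_distrib]
  -- The constraint at `x₀` is deterministic, so it joins the box in `K` and only sampled
  -- constraints count in the bound.
  let K : Set (Param m) := affineOf (φ x₀) (b x₀) ⁻¹' Set.Ici ε₀ ∩ Set.Icc (-U) U
  have hKmem : ∀ a, a ∈ K ↔ ε₀ ≤ h a x₀ ∧ InBox U a := by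
    intro a
    simp only [K, Set.mem_inter_iff, Set.mem_preimage, Set.mem_Ici, affineOf_apply, ← hφ,
      InBox, Set.mem_Icc, Pi.le_def, Pi.neg_apply, forall_and]
  have hKc : IsCompact K := isCompact_Icc.inter_left
    (isClosed_Ici.preimage (affineOf (φ x₀) (b x₀)).continuous_of_finiteDimensional)
  have hK : Convex ℝ K := ((convex_Ici ε₀).affine_preimage _).inter (convex_Icc _ _)
  have hAm : ∀ a, Measurable fun x => A x a := by
    intro a
    simp only [hA]
    exact ((h_meas a).comp hf.measurable).sub ((h_meas a).const_mul γ)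
  have hfeas : ∀ (X : Fin N → State n) a,
      a ∈ feasibleSet K A X ↔ TieBreakFeasible f h x₀ ε₀ γ U X a := by
    intro X a
    simp only [feasibleSet, Set.mem_ofPred_eq, hKmem, hA, sub_nonneg, TieBreakFeasible]
    tauto
  obtain ⟨D, hDm, hD, hDV⟩ := exists_measurableSet_violation_le (N := N) (uniformDist 𝒳) hKc hK
    hAm c (strictConcaveOn_neg_sum_sq m) (by fun_prop) hα.2.le
  rw [Module.finrank_fin_fun] at hD
  have hDβ := hD.trans (two_pow_mul_pow_le hα.2.le hβ.1 hN hαN)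
  have hmem : ∀ᵐ X ∂sampleDist 𝒳 N, ∀ i, X i ∈ 𝒳 := by
    refine ae_all_iff.2 fun i => ?_
    exact (Measure.tendsto_eval_ae_ae (μ := fun _ : Fin N => uniformDist 𝒳)).eventually
      (ae_cond_mem h𝒳)
  have hprob : IsProbabilityMeasure (sampleDist 𝒳 N) := by
    unfold sampleDist; infer_instance
  -- `aStar` and `lamStar` need not be measurable, so the exceptional null set is enlarged to a
  -- measurable one.
  obtain ⟨Z, hZ, hZm, hZ0⟩ := exists_measurable_superset_of_null
    (ae_iff.1 (hmem.and h_unique))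
  refine ⟨(D ∪ Z)ᶜ, (hDm.union hZm).compl, ?_, ?_⟩
  · rw [probReal_compl_eq_one_sub (hDm.union hZm)]
    have hZr : (sampleDist 𝒳 N).real Z = 0 := by rw [measureReal_def, hZ0, ENNReal.toReal_zero]
    have hD' : (sampleDist 𝒳 N).real D ≤ β := hDβ
    have := measureReal_union_le (μ := sampleDist 𝒳 N) D Z
    linarith
  intro X hX hlam
  rw [Set.compl_union] at hX
  have hXZ : (∀ i, X i ∈ 𝒳) ∧ (lamStar X = 0 → ∀ a,
      IsTieBreakOptimal f h x₀ ε₀ γ U x' X a → a = aStar X) := by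
    by_contra hcon
    exact hX.2 (hZ hcon)
  have htie := h_tie X hXZ.1 hlam
  have hV : (uniformDist 𝒳).real {x | A x (aStar X) < 0} ≤ α := by
    refine hDV X hX.1 (aStar X) ((hfeas X _).2 htie.1) (fun a ha => ?_) fun a ha hca => ?_
    · rw [hc, hc]; exact htie.2 a ((hfeas X a).1 ha)
    · rw [hc, hc] at hca
      exact hXZ.2 hlam a ⟨(hfeas X a).1 ha, fun a' ha' => hca ▸ htie.2 a' ha'⟩
  have hbox : InBox U (aStar X) := htie.1.2.2
  have hSm : MeasurableSet (superlevel 𝒳 h (aStar X)) :=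
    h𝒳.inter (measurableSet_le measurable_const (h_meas _))
  have hpos : 0 < (uniformDist 𝒳).real (superlevel 𝒳 h (aStar X)) := by
    -- Since `h(a*, x₀) ≥ ε₀ > 0`, continuity on `𝒳` keeps `h(a*, ·)` positive on `V ∩ 𝒳`, which has
    -- positive volume.
    obtain ⟨V, hVnhds, hVsub⟩ := mem_nhdsWithin_iff_exists_mem_nhds_inter.1
      ((h_cont (aStar X) x₀ hx₀).eventually (lt_mem_nhds (hε₀.trans_le htie.1.1)))
    have hsub : V ∩ 𝒳 ⊆ superlevel 𝒳 h (aStar X) := fun x hx => ⟨hx.2, (hVsub hx).le⟩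
    refine ENNReal.toReal_pos (uniformDist_pos_of_volume_ne_zero h𝒳 h𝒳_fin (fun x hx => hx.1)
      fun h0 => hx₀_nhds V hVnhds (measure_mono_null hsub h0)) (measure_ne_top _ _)
  refine ⟨hpos, one_sub_div_le_cond_real hSm hpos ((measureReal_mono ?_).trans hV)⟩
  rintro x ⟨hxS, hxf⟩
  change A x (aStar X) < 0
  rw [hA]
  -- Otherwise `h(a*, f x) ≥ γ h(a*, x) ≥ 0`; negativity of the template off `𝒳` then forces `f x ∈
  -- 𝒳`, so `f x` would stay in the superlevel set.
  by_contra! hge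
  have hfx : 0 ≤ h (aStar X) (f x) := by
    have := mul_nonneg hγ.1.le hxS.2
    linarith
  refine hxf ⟨?_, hfx⟩
  by_contra hout
  exact absurd (h_neg _ hbox _ hout) (not_lt.2 hfx)
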